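/- Let $n\ge 3$ and $[n]=\{1,2,\dots,n\}$. A universal cycle for the $2$-permutations of $[n]$ is a cyclic arrangement $(x_1,x_2,\dots,x_{n(n-1)})$ of elements of $[n]$ (sequences that differ by a rotation are identified) in which each ordered pair $(a,b)$ of distinct elements of $[n]$ appears exactly once as two consecutive entries, that is, $(a,b)=(x_i,x_{i+1})$ for exactly one index $i\in\{1,\dots,n(n-1)\}$, where $x_{n(n-1)+1}=x_1$. The number of universal cycles for the $2$-permutations of $[n]$ is $$n^{n-2}\,[(n-2)!]^{n}.$$ -/

import Mathlib

open scoped Nat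

/-- A `k`-permutation of an `n`-set, here `Fin n`: an ordered arrangement of `k` distinct
elements, the `j`-th of which is `p j`. -/
abbrev KPermutation (n k : ℕ) : Type := Fin k ↪ Fin n

/-- The blocks of `k` consecutive elements of a cyclic arrangement `c`, counted with multiplicity:
one for each position of `c`, namely the first `k` entries of `c` read cyclically from there. -/
def cyclicBlocks {α : Type*} (k : ℕ) (c : Cycle α) : Multiset (List α) :=
  c.lists.map (List.take k)

/-- A universal cycle for the `k`-permutations of `Fin n`: a cyclic arrangement of elements of
`Fin n` whose length is the number of `k`-permutations, and in which each `k`-permutation appears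
exactly once as `k` consecutive elements. Two sequences that are rotations of each other are the
same `Cycle`. -/
def IsUniversalCycle (n k : ℕ) (c : Cycle (Fin n)) : Prop :=
  c.length = Fintype.card (KPermutation n k) ∧
    ∀ p : KPermutation n k, (cyclicBlocks k c).count (List.ofFn p) = 1

/-!
Universal cycles for the `2`-permutations of `[n]` are the Eulerian circuits of the complete
loopless digraph on `[n]`, which the BEST theorem counts as `∏ v, (d v - 1)!` times a cofactor
of the Laplacian, where `d v` is the in-degree of `v`; here `d v = n - 1` and the cofactor is
`n ^ (n - 2)`.

The BEST theorem is proved by induction on the number of edges. Encode an Eulerian circuit as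
the permutation sending each edge to its successor, and fix an edge `e` ending at a vertex `v`
other than the root. Merging `e` with its successor gives an Eulerian circuit of a smaller
multigraph, so the count is the sum, over the edges `f` leaving `v`, of the counts for the
multigraphs in which `e` and `f` are spliced into one edge. Splicing changes the Laplacian by a
rank-one matrix, and since the determinant is linear in each row, the product of factorials and
cofactor obeys the same recursion. When all edges are loops at the root, both sides equal
`(d r - 1)!` for the root `r`.
-/

section Determinant
open Matrix

variable {V R : Type*} [Fintype V] [DecidableEq V]

theorem det_one_add_vecMulVec [CommRing R] (u v : V → R) :
    (1 + vecMulVec u v).det = 1 + v ⬝ᵥ u := by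
  rw [vecMulVec_eq Unit, det_one_add_replicateCol_mul_replicateRow]

theorem det_sub_vecMulVec_eq_det_fromBlocks [CommRing R] (M : Matrix V V R) (u v : V → R) :
    (M - vecMulVec u v).det =
      (fromBlocks M (replicateCol Unit u) (replicateRow Unit v) 1).det := by
  rw [det_fromBlocks_one₂₂, vecMulVec_eq Unit]

-- Written as a bordered determinant, each summand is linear in its last row, so the sum is governed
-- by the sum of the last rows, from which the row `M v` can be subtracted.
theorem sum_det_sub_vecMulVec [CommRing R] {ι : Type*} (M : Matrix V V R) (u : V → R)
    (S : Finset ι) (δ : ι → V → R) (v : V) (hδ : ∑ i ∈ S, δ i = M v) :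
    ∑ i ∈ S, (M - vecMulVec u (δ i)).det = (S.card - u v) * M.det := by
  let B : Matrix (V ⊕ Unit) (V ⊕ Unit) R := fromBlocks M (replicateCol Unit u) 0 1
  let detLast : (V ⊕ Unit → R) →ₗ[R] R :=
    (detRowAlternating (R := R)).toMultilinearMap.toLinearMap B (Sum.inr ())
  have detLast_elim (x : V → R) (c : R) : detLast (Sum.elim x fun _ => c) =
      (fromBlocks M (replicateCol Unit u) (replicateRow Unit x) (of fun _ _ => c)).det := by
    change (B.updateRow _ _).det = _
    congr 1
    ext (i | i) (j | j) <;> simp [B, updateRow_apply]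
  have detLast_row : detLast (Sum.elim (M v) fun _ => u v) = 0 := by
    change (B.updateRow _ _).det = 0
    refine det_zero_of_row_eq (i := Sum.inr ()) (j := Sum.inl v) (by simp) ?_
    ext (j | j) <;> simp [B, updateRow_apply]
  have one_eq : (1 : Matrix Unit Unit R) = of fun _ _ => 1 := by ext; simp
  calc ∑ i ∈ S, (M - vecMulVec u (δ i)).det
      = detLast (∑ i ∈ S, Sum.elim (δ i) fun _ => 1) := by
        simp only [map_sum, detLast_elim, det_sub_vecMulVec_eq_det_fromBlocks, one_eq]
    _ = detLast (Sum.elim (M v) (fun _ => u v) + Sum.elim (0 : V → R) fun _ => S.card - u v) := by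
        congr 1
        ext (x | x) <;> simp [Finset.sum_apply, ← hδ]
    _ = (S.card - u v) * M.det := by
        rw [map_add, detLast_row, zero_add, detLast_elim,
          show replicateRow Unit (0 : V → R) = 0 from rfl, det_fromBlocks_zero₂₁, mul_comm]
        simp

theorem det_sub_vecMulVec_add_single [CommRing R] (M : Matrix V V R) {v : V} (hv : M v v = 1) :
    (M - vecMulVec (M.col v) (M v) + single v v 1).det = M.det := by
  let e : V → R := Pi.single v 1
  have row_v : e ᵥ* M = M v := single_one_vecMul v M
  have col_v : M *ᵥ e = M.col v := mulVec_single_one M v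
  have single_eq : single v v (1 : R) = vecMulVec e e := by
    simp [e, single_eq_single_vecMulVec_single]
  have factored : M - vecMulVec (M.col v) (M v) + single v v 1 =
      (1 + vecMulVec (e - M.col v) e) * M * (1 + vecMulVec e (e - M v)) := by
    have pivot : M v ⬝ᵥ e = 1 := by simp [e, hv]
    simp only [add_mul, mul_add, one_mul, mul_one, vecMulVec_mul, mul_vecMulVec, row_v, col_v,
      vecMulVec_mulVec, pivot, single_eq, MulOpposite.op_one, one_smul]
    simp only [sub_vecMulVec, vecMulVec_sub]
    abel
  rw [factored, det_mul, det_mul, det_one_add_vecMulVec, det_one_add_vecMulVec]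
  simp [e, hv]

theorem det_diagonal_sub_vecMulVec_one [Field R] (b : V → R) (hb : ∀ i, b i ≠ 0) :
    (diagonal b - vecMulVec 1 1).det = (∏ i, b i) * (1 - ∑ i, (b i)⁻¹) := by
  have factored : diagonal b - vecMulVec 1 1 = diagonal b * (1 + vecMulVec (-b⁻¹) 1) := by
    ext i j
    by_cases hij : i = j <;> simp [diagonal_mul, mul_add, hij, hb, sub_eq_add_neg]
  rw [factored, det_mul, det_diagonal, det_one_add_vecMulVec]
  simp [dotProduct, sub_eq_add_neg]

theorem det_diagonal_update_card_sub_vecMulVec_one [Nontrivial V] [Field R] [CharZero R] (r : V) :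
    (diagonal (Function.update (fun _ => (Fintype.card V : R)) r (Fintype.card V + 1)) -
      vecMulVec 1 1).det = (Fintype.card V : R) ^ (Fintype.card V - 2) := by
  obtain ⟨k, hk⟩ : ∃ k, Fintype.card V = k + 2 :=
    Nat.exists_eq_add_of_le' (Fintype.one_lt_card (α := V))
  have card_compl : (Finset.univ \ {r} : Finset V).card = k + 1 := by
    rw [Finset.card_sdiff_of_subset (by simp), Finset.card_univ, hk]; simp
  have h0 : (k : R) + 2 ≠ 0 := by exact_mod_cast (k + 1).succ_ne_zero
  have h1 : (k : R) + 2 + 1 ≠ 0 := by exact_mod_cast (k + 2).succ_ne_zero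
  rw [det_diagonal_sub_vecMulVec_one]
  · simp_rw [← Function.comp_apply (f := Inv.inv), Function.comp_update]
    rw [Finset.prod_update_of_mem (Finset.mem_univ r), Finset.sum_update_of_mem (Finset.mem_univ r)]
    simp only [hk, card_compl, Function.comp_apply, Finset.prod_const, Finset.sum_const,
      nsmul_eq_mul, Nat.cast_add, Nat.cast_ofNat, Nat.cast_one, Nat.add_sub_cancel]
    field_simp
    ring
  · intro i
    by_cases hi : i = r
    · simpa [hi, hk] using h1
    · simpa [hi, hk] using h0

end Determinant


section EulerianCircuits
open Equiv Equiv.Perm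
open scoped Finset

variable {α E V : Type*}

theorem rel_of_sameCycle {σ : Perm E} (r : Setoid E) (h : ∀ x, r x (σ x)) {x y : E}
    (hxy : σ.SameCycle x y) : r x y := by
  obtain ⟨i, rfl⟩ := hxy
  induction i with
  | zero => exact r.refl x
  | succ i ih =>
    rw [add_comm, zpow_add, mul_apply, zpow_one]
    exact r.trans ih (h _)
  | pred i ih =>
    refine r.trans ih (r.symm ?_)
    simpa [← mul_apply, ← zpow_one_add] using h ((σ ^ (-(i : ℤ) - 1)) x)

theorem sameCycle_map_of_semiconj {F : Type*} {σ : Perm E} {τ : Perm F} {f : E → F}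
    (h : Function.Semiconj f σ τ) {x y : E} (hxy : σ.SameCycle x y) :
    τ.SameCycle (f x) (f y) :=
  rel_of_sameCycle ((SameCycle.setoid τ).comap f)
    (fun x => show τ.SameCycle (f x) (f (σ x)) by rw [h]; exact ⟨1, rfl⟩) hxy

theorem apply_ne_of_forall_sameCycle [Nontrivial E] {σ : Perm E} (h : ∀ x y, σ.SameCycle x y)
    (x : E) : σ x ≠ x := by
  intro hx
  obtain ⟨y, hy⟩ := exists_ne x
  exact hy ((h x y).eq_of_left hx).symm

theorem decomposeOption_symm_some_apply_some [DecidableEq α] (i : α) (τ : Perm α) (x : α) :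
    decomposeOption.symm (some i, τ) (some x) = if τ x = i then none else some (τ x) := by
  split_ifs with h
  · simp [h]
  · simp [swap_apply_of_ne_of_ne, h]

theorem forall_sameCycle_decomposeOption_symm_some [DecidableEq α] (i : α) (τ : Perm α) :
    (∀ x y, (decomposeOption.symm (some i, τ)).SameCycle x y) ↔ ∀ x y, τ.SameCycle x y := by
  set σ := decomposeOption.symm (some i, τ) with hσ
  have σ_none : σ none = some i := by simp [hσ]
  have σ_some : ∀ x, σ (some x) = if τ x = i then none else some (τ x) :=
    decomposeOption_symm_some_apply_some i τ
  constructor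
  · intro h x y
    refine rel_of_sameCycle ((SameCycle.setoid τ).comap fun a : Option α => a.getD i) ?_
      (h (some x) (some y))
    rintro (_ | x)
    · exact show τ.SameCycle i ((σ none).getD i) by rw [σ_none]; rfl
    · change τ.SameCycle x ((σ (some x)).getD i)
      rw [σ_some]
      split_ifs with hx
      · exact ⟨1, hx⟩
      · exact ⟨1, rfl⟩
  · intro h
    have some_some (x y : α) : σ.SameCycle (some x) (some y) := by
      refine rel_of_sameCycle ((SameCycle.setoid σ).comap some) (fun x => ?_) (h x y)
      change σ.SameCycle (some x) (some (τ x))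
      by_cases hx : τ x = i
      · exact ⟨2, by simp [pow_succ, zpow_ofNat, σ_some, hx, σ_none]⟩
      · exact ⟨1, by simp [σ_some, hx]⟩
    have none_some (y : α) : σ.SameCycle none (some y) :=
      .trans ⟨1, σ_none⟩ (some_some i y)
    rintro (_ | x) (_ | y)
    · exact .refl _ _
    · exact none_some y
    · exact (none_some x).symm
    · exact some_some x y

/-- An Eulerian circuit of the directed multigraph with edge set `E`, source map `s` and target
map `t`, encoded as the permutation that sends each edge to the next one on the circuit. -/
def IsEulerianCircuit (s t : E → V) (σ : Perm E) : Prop :=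
  (∀ e f, σ.SameCycle e f) ∧ ∀ e, s (σ e) = t e

/-- The number of Eulerian circuits of a directed multigraph, the quantity evaluated by the BEST
theorem. -/
noncomputable def eulerCount (s t : E → V) : ℕ :=
  {σ | IsEulerianCircuit s t σ}.ncard

/-- The source map of the multigraph obtained by splicing the edge `none` with the edge `some i`,
which is meant to start where `none` ends: the two become one edge, still called `i`, running from
the source of `none` to the target of `some i`. The target map of the new multigraph is the old
one restricted to `α`. -/
def spliceSource [DecidableEq α] (s : Option α → V) (i : α) : α → V :=
  Function.update (s ∘ some) i (s none)

theorem eulerCount_comp_equiv {F : Type*} (f : F ≃ E) (s t : E → V) :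
    eulerCount (s ∘ f) (t ∘ f) = eulerCount s t := by
  refine Nat.card_congr (f.permCongr.subtypeEquiv fun σ => and_congr ?_ ?_)
  · have conj : Function.Semiconj f σ (f.permCongr σ) := fun x => by simp
    have conj_symm : Function.Semiconj f.symm (f.permCongr σ) σ := fun x => by simp
    exact ⟨fun h x y => by simpa using sameCycle_map_of_semiconj conj (h (f.symm x) (f.symm y)),
      fun h x y => by simpa using sameCycle_map_of_semiconj conj_symm (h (f x) (f y))⟩
  · simp [f.forall_congr_left]

theorem isEulerianCircuit_decomposeOption_symm_some [DecidableEq α] (s t : Option α → V) (i : α)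
    (τ : Perm α) :
    IsEulerianCircuit s t (decomposeOption.symm (some i, τ)) ↔
      s (some i) = t none ∧ IsEulerianCircuit (spliceSource s i) (t ∘ some) τ := by
  rw [IsEulerianCircuit, IsEulerianCircuit, forall_sameCycle_decomposeOption_symm_some,
    and_left_comm, Option.forall]
  refine and_congr_right' (and_congr (by simp) (forall_congr' fun x => ?_))
  rw [decomposeOption_symm_some_apply_some]
  by_cases h : τ x = i <;> simp [spliceSource, h]

theorem not_isEulerianCircuit_decomposeOption_symm_none [DecidableEq α] [Nonempty α]
    (s t : Option α → V) (τ : Perm α) :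
    ¬ IsEulerianCircuit s t (decomposeOption.symm (none, τ)) :=
  fun h => apply_ne_of_forall_sameCycle h.1 none (by simp)

theorem eulerCount_option [Fintype α] [DecidableEq α] [DecidableEq V] [Nonempty α]
    (s t : Option α → V) :
    eulerCount s t = ∑ i with s (some i) = t none, eulerCount (spliceSource s i) (t ∘ some) := by
  classical
  have eulerCount_eq_sum {E : Type _} [Fintype E] [DecidableEq E] (s t : E → V) :
      eulerCount s t = ∑ σ, if IsEulerianCircuit s t σ then 1 else 0 := by
    rw [eulerCount, Set.ncard_eq_toFinset_card', Set.toFinset_ofPred, Finset.card_filter]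
  rw [eulerCount_eq_sum, ← decomposeOption.symm.sum_comp, Fintype.sum_prod_type,
    Fintype.sum_option, Finset.sum_filter]
  simp only [not_isEulerianCircuit_decomposeOption_symm_none, if_false, Finset.sum_const_zero,
    zero_add, isEulerianCircuit_decomposeOption_symm_some, ite_and, eulerCount_eq_sum]
  refine Finset.sum_congr rfl fun i _ => ?_
  split_ifs <;> simp

theorem eulerCount_of_unique [Unique E] {s t : E → V} (h : s default = t default) :
    eulerCount s t = 1 := by
  have : {σ | IsEulerianCircuit s t σ} = {1} := by
    refine Set.eq_singleton_iff_unique_mem.2 ⟨⟨fun e f => ?_, fun e => ?_⟩, fun σ _ => ?_⟩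
    · rw [Subsingleton.elim e f]
    · rw [Unique.eq_default e]; exact h
    · exact Subsingleton.elim _ _
  rw [eulerCount, this, Set.ncard_singleton]

theorem eulerCount_of_forall_eq [Fintype E] {n : ℕ} (hE : Fintype.card E = n + 1) {s t : E → V}
    {r : V} (hs : ∀ e, s e = r) (ht : ∀ e, t e = r) : eulerCount s t = n ! := by
  classical
  induction n generalizing E with
  | zero =>
    have := (Fintype.card_eq_one_iff_nonempty_unique.1 hE).some
    exact eulerCount_of_unique ((hs _).trans (ht _).symm)
  | succ n ih =>
    obtain ⟨e⟩ : Nonempty E := Fintype.card_pos_iff.1 (by omega)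
    have card_ne : Fintype.card {f // f ≠ e} = n + 1 := by simp [Fintype.card_subtype_compl, hE]
    have : Nonempty {f // f ≠ e} := Fintype.card_pos_iff.1 (by omega)
    rw [← eulerCount_comp_equiv (optionSubtypeNe e), eulerCount_option]
    have spliced (i : {f // f ≠ e}) : eulerCount (spliceSource (s ∘ optionSubtypeNe e) i)
        ((t ∘ optionSubtypeNe e) ∘ some) = n ! := by
      refine ih card_ne (fun x => ?_) fun x => ht _
      by_cases hx : x = i <;> simp [spliceSource, hx, hs]
    simp_rw [spliced, Function.comp_apply, hs, ht, Finset.filter_true]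
    rw [Finset.sum_const, Finset.card_univ, card_ne, smul_eq_mul, Nat.factorial_succ]

end EulerianCircuits

section BEST
open Equiv Matrix
open scoped Finset

variable {α E V : Type*} [Fintype α] [Fintype E]

theorem sum_spliceSource_add [DecidableEq α] {A : Type*} [AddCommMonoid A] (F : V → V → A)
    (s t : Option α → V) (i : α) :
    ∑ x, F (spliceSource s i x) (t (some x)) +
        (F (s none) (t none) + F (s (some i)) (t (some i))) =
      ∑ e, F (s e) (t e) + F (s none) (t (some i)) := by
  have others : ∑ x ∈ Finset.univ.erase i, F (spliceSource s i x) (t (some x)) =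
      ∑ x ∈ Finset.univ.erase i, F (s (some x)) (t (some x)) :=
    Finset.sum_congr rfl fun x hx => by simp [spliceSource, Finset.ne_of_mem_erase hx]
  rw [Fintype.sum_option, ← Finset.add_sum_erase _ _ (Finset.mem_univ i), others,
    ← Finset.add_sum_erase _ (fun x => F (s (some x)) (t (some x))) (Finset.mem_univ i)]
  simp only [spliceSource, Function.update_self]
  abel

variable [DecidableEq V]

/-- A directed multigraph is balanced if every vertex has as many outgoing as incoming edges; a
loop counts as both. -/
def IsBalanced (s t : E → V) : Prop :=
  ∀ v, #{e | s e = v} = #{e | t e = v}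

theorem card_filter_option (t : Option α → V) (v : V) :
    #{e | t e = v} = (if t none = v then 1 else 0) + #{x | t (some x) = v} := by
  simp only [Finset.card_filter, Fintype.sum_option]

theorem IsBalanced.splice [DecidableEq α] {s t : Option α → V} (h : IsBalanced s t) {i : α}
    (hi : s (some i) = t none) : IsBalanced (spliceSource s i) (t ∘ some) := by
  intro v
  have sources := sum_spliceSource_add (fun a _ => if a = v then 1 else 0) s t i
  have balance := h v
  rw [card_filter_option t] at balance
  simp only [← Finset.card_filter, hi] at sources
  simp only [Function.comp_apply]
  omega

theorem IsBalanced.comp_equiv {F : Type*} [Fintype F] {s t : E → V} (h : IsBalanced s t)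
    (f : F ≃ E) : IsBalanced (s ∘ f) (t ∘ f) := by
  intro v
  have card_comp (g : E → V) : #{x | (g ∘ f) x = v} = #{e | g e = v} :=
    Finset.card_equiv f (by simp)
  rw [card_comp, card_comp, h v]

theorem prod_factorial_card_option [Fintype V] (t : Option α → V) :
    ∏ v, (#{e | t e = v} - 1)! =
      (if ∃ x, t (some x) = t none then #{e | t e = t none} - 1 else 1) *
        ∏ v, (#{x | t (some x) = v} - 1)! := by
  have others : ∏ v ∈ Finset.univ.erase (t none), (#{e | t e = v} - 1)! =
      ∏ v ∈ Finset.univ.erase (t none), (#{x | t (some x) = v} - 1)! :=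
    Finset.prod_congr rfl fun v hv => by
      rw [card_filter_option, if_neg (Finset.ne_of_mem_erase hv).symm, zero_add]
  rw [← Finset.mul_prod_erase _ _ (Finset.mem_univ (t none)), others,
    ← Finset.mul_prod_erase _ (fun v => (#{x | t (some x) = v} - 1)!) (Finset.mem_univ (t none)),
    ← mul_assoc, card_filter_option, if_pos rfl, Nat.add_sub_cancel_left]
  congr 1
  split_ifs with h
  · obtain ⟨x, hx⟩ := h
    exact (Nat.mul_factorial_pred (Finset.card_ne_zero_of_mem (a := x) (by simpa using hx))).symm
  · push Not at h
    simp [h]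

/-- The Laplacian of a directed multigraph, with `1` added to the diagonal entry of the root `r`,
so that its determinant is the cofactor at `r`. The diagonal entry of a vertex that is the target
of no edge is also increased by `1`: in a balanced multigraph such a vertex is isolated, and thus
does not affect the determinant. -/
def rootedLaplacian [Fintype V] (r : V) (s t : E → V) : Matrix V V ℚ :=
  ∑ e, vecMulVec (Pi.single (s e) 1) (Pi.single (s e) 1 - Pi.single (t e) 1) +
    diagonal fun v => if v = r ∨ ∀ e, t e ≠ v then 1 else 0

theorem rootedLaplacian_comp_equiv {F : Type*} [Fintype F] [Fintype V] (f : F ≃ E) (r : V)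
    (s t : E → V) : rootedLaplacian r (s ∘ f) (t ∘ f) = rootedLaplacian r s t := by
  simp only [rootedLaplacian, Function.comp_apply, f.forall_congr_left, apply_symm_apply]
  congr 1
  exact f.sum_comp fun e =>
    vecMulVec (Pi.single (s e) (1 : ℚ)) (Pi.single (s e) 1 - Pi.single (t e) 1)

theorem rootedLaplacian_of_forall_eq [Fintype V] [Nonempty E] {s t : E → V} {r : V}
    (hs : ∀ e, s e = r) (ht : ∀ e, t e = r) : rootedLaplacian r s t = 1 := by
  have (v : V) : v = r ∨ r ≠ v := by tauto
  simp [rootedLaplacian, hs, ht, this]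

theorem rootedLaplacian_row [Fintype V] {r : V} {s t : E → V} {v : V} (hv : v ≠ r)
    (h : ∃ e, t e = v) :
    rootedLaplacian r s t v = ∑ e with s e = v, (Pi.single v 1 - Pi.single (t e) 1) := by
  rw [Finset.sum_filter]
  ext w
  have diag_eq_zero : (diagonal fun v => if v = r ∨ ∀ e, t e ≠ v then (1 : ℚ) else 0) v w = 0 := by
    simp [diagonal_apply, hv, h]
  rw [rootedLaplacian, Matrix.add_apply, diag_eq_zero, add_zero, Matrix.sum_apply,
    Finset.sum_apply]
  refine Finset.sum_congr rfl fun e _ => ?_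
  by_cases he : s e = v <;> simp [vecMulVec_apply, he, Ne.symm]

theorem rootedLaplacian_col [Fintype V] {r : V} {s t : E → V} {v : V} (hv : v ≠ r)
    (h : ∃ e, t e = v) :
    (rootedLaplacian r s t).col v =
      ∑ e with s e = v, Pi.single v 1 - ∑ e with t e = v, Pi.single (s e) 1 := by
  rw [Finset.sum_filter, Finset.sum_filter, ← Finset.sum_sub_distrib]
  ext w
  have diag_eq_zero : (diagonal fun v => if v = r ∨ ∀ e, t e ≠ v then (1 : ℚ) else 0) w v = 0 := by
    by_cases hw : w = v <;> simp [hw, hv, h]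
  rw [col_apply, rootedLaplacian, Matrix.add_apply, diag_eq_zero, add_zero, Matrix.sum_apply,
    Finset.sum_apply]
  refine Finset.sum_congr rfl fun e _ => ?_
  by_cases he : s e = v <;> by_cases he' : t e = v <;>
    simp [vecMulVec_apply, he, he', Pi.single_apply, eq_comm]

theorem rootedLaplacian_splice [DecidableEq α] [Fintype V] {r : V} {s t : Option α → V} {i : α}
    (hr : t none ≠ r) (hi : s (some i) = t none) :
    rootedLaplacian r (spliceSource s i) (t ∘ some) =
      rootedLaplacian r s t -
        vecMulVec (Pi.single (t none) 1 - Pi.single (s none) 1)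
          (Pi.single (t none) 1 - Pi.single (t (some i)) 1) +
        if ∃ x, t (some x) = t none then 0 else single (t none) (t none) 1 := by
  have diag_eq : (diagonal fun v => if v = r ∨ ∀ x, t (some x) ≠ v then (1 : ℚ) else 0) =
      (diagonal fun v => if v = r ∨ ∀ e, t e ≠ v then (1 : ℚ) else 0) +
        if ∃ x, t (some x) = t none then 0 else single (t none) (t none) 1 := by
    have target_exists : ¬ ∀ e, t e ≠ t none := fun h => h none rfl
    split_ifs with h
    · rw [add_zero]
      congr 1
      ext v
      by_cases hv : t none = v
      · subst hv
        have : ¬ ∀ x, t (some x) ≠ t none := by simpa using h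
        simp only [hr, this, target_exists]
      · simp [Option.forall, hv]
    · rw [← diagonal_single, diagonal_add]
      congr 1
      ext v
      by_cases hv : t none = v
      · subst hv
        push Not at h
        simp only [hr, target_exists, h, implies_true, ne_eq, not_false_eq_true, or_true, or_false,
          if_true, if_false, Pi.single_eq_same, zero_add]
      · simp [Option.forall, hv, Ne.symm hv]
  have sum_eq := sum_spliceSource_add (fun a b : V =>
    vecMulVec (Pi.single a (1 : ℚ)) (Pi.single a 1 - Pi.single b 1)) s t i
  rw [← eq_sub_iff_add_eq] at sum_eq
  simp only [rootedLaplacian, Function.comp_apply]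
  rw [diag_eq, sum_eq, hi]
  simp only [sub_vecMulVec, vecMulVec_sub]
  abel

theorem sum_det_rootedLaplacian_splice_of_exists [DecidableEq α] [Fintype V] {r : V}
    {s t : Option α → V} (hbal : IsBalanced s t) (hr : t none ≠ r) (h : ∃ x, t (some x) = t none) :
    ∑ i with s (some i) = t none, (rootedLaplacian r (spliceSource s i) (t ∘ some)).det =
      (#{e | t e = t none} - 1) * (rootedLaplacian r s t).det := by
  set M := rootedLaplacian r s t
  set u : V → ℚ := Pi.single (t none) 1 - Pi.single (s none) 1 with hu
  have splice_eq : ∀ i ∈ ({i | s (some i) = t none} : Finset α),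
      (rootedLaplacian r (spliceSource s i) (t ∘ some)).det =
        (M - vecMulVec u (Pi.single (t none) 1 - Pi.single (t (some i)) 1)).det := fun i hi => by
    rw [rootedLaplacian_splice hr (by simpa using hi), if_pos h, add_zero]
  have sum_all := sum_det_sub_vecMulVec M u {e | s e = t none}
    (fun e => Pi.single (t none) 1 - Pi.single (t e) 1) (t none)
    (rootedLaplacian_row hr ⟨none, rfl⟩).symm
  rw [hbal, Finset.sum_filter, Fintype.sum_option, ← Finset.sum_filter] at sum_all
  rw [Finset.sum_congr rfl splice_eq]
  by_cases hloop : s none = t none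
  · have u_eq : u = 0 := by simp [hu, hloop]
    simp only [hloop, if_true, u_eq, zero_vecMulVec, sub_zero, Pi.zero_apply] at sum_all ⊢
    linear_combination sum_all
  · have u_apply : u (t none) = 1 := by simp [hu, Ne.symm hloop]
    simpa [hloop, u_apply] using sum_all

theorem sum_det_rootedLaplacian_splice_of_forall_ne [DecidableEq α] [Fintype V] {r : V}
    {s t : Option α → V} (hbal : IsBalanced s t) (hr : t none ≠ r) (h : ∀ x, t (some x) ≠ t none) :
    ∑ i with s (some i) = t none, (rootedLaplacian r (spliceSource s i) (t ∘ some)).det =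
      (rootedLaplacian r s t).det := by
  have inEdges : ({e | t e = t none} : Finset (Option α)) = {none} := by
    ext e; cases e <;> simp [h]
  obtain ⟨e, outEdges⟩ : ∃ e, ({e | s e = t none} : Finset (Option α)) = {e} := by
    rw [← Finset.card_eq_one, hbal, inEdges, Finset.card_singleton]
  have source_eq_iff (f : Option α) : s f = t none ↔ f = e := by
    simpa using Finset.ext_iff.1 outEdges f
  have row : rootedLaplacian r s t (t none) = Pi.single (t none) 1 - Pi.single (t e) 1 := by
    rw [rootedLaplacian_row hr ⟨none, rfl⟩, outEdges, Finset.sum_singleton]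
  cases e with
  | none =>
    rw [sub_self] at row
    rw [det_eq_zero_of_row_eq_zero (t none) (congrFun row)]
    simp [source_eq_iff]
  | some i =>
    have col : (rootedLaplacian r s t).col (t none) =
        Pi.single (t none) 1 - Pi.single (s none) 1 := by
      rw [rootedLaplacian_col hr ⟨none, rfl⟩, outEdges, inEdges, Finset.sum_singleton,
        Finset.sum_singleton]
    have pivot : rootedLaplacian r s t (t none) (t none) = 1 := by
      simp [row, (h i).symm]
    have splicings : ({x | s (some x) = t none} : Finset α) = {i} := by
      ext x; simp [source_eq_iff]
    rw [splicings, Finset.sum_singleton, rootedLaplacian_splice hr ((source_eq_iff _).2 rfl),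
      if_neg (by simpa using h), ← row, ← col, det_sub_vecMulVec_add_single _ pivot]

theorem prod_factorial_mul_det_option [DecidableEq α] [Fintype V] {r : V} {s t : Option α → V}
    (hbal : IsBalanced s t) (hr : t none ≠ r) :
    (∏ v, (#{e | t e = v} - 1)! : ℕ) * (rootedLaplacian r s t).det =
      ∑ i with s (some i) = t none, (∏ v, (#{x | t (some x) = v} - 1)! : ℕ) *
        (rootedLaplacian r (spliceSource s i) (t ∘ some)).det := by
  rw [← Finset.mul_sum, prod_factorial_card_option]
  split_ifs with h
  · have card_pos : 1 ≤ #{e | t e = t none} := Finset.card_pos.2 ⟨none, by simp⟩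
    rw [sum_det_rootedLaplacian_splice_of_exists hbal hr h, Nat.cast_mul, Nat.cast_sub card_pos]
    push_cast
    ring
  · rw [sum_det_rootedLaplacian_splice_of_forall_ne hbal hr (by simpa using h), one_mul]

theorem IsBalanced.eulerCount_of_forall_target_eq [Fintype V] {s t : E → V} (hbal : IsBalanced s t)
    {r : V} (ht : ∀ e, t e = r) [Nonempty E] :
    (eulerCount s t : ℚ) =
      (∏ v, (#{e | t e = v} - 1)! : ℕ) * (rootedLaplacian r s t).det := by
  have hs (e : E) : s e = r := by
    have card_eq : #{e | s e = r} = #(Finset.univ : Finset E) := by simp [hbal r, ht]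
    exact Finset.filter_card_eq card_eq e (Finset.mem_univ e)
  have card_eq : Fintype.card E = Fintype.card E - 1 + 1 :=
    (Nat.sub_add_cancel Fintype.card_pos).symm
  have prod_eq : ∏ v, (#{e | t e = v} - 1)! = (Fintype.card E - 1)! := by
    rw [Fintype.prod_eq_single r fun v hv => by simp [ht, hv.symm]]
    simp [ht]
  rw [eulerCount_of_forall_eq card_eq hs ht, rootedLaplacian_of_forall_eq hs ht, det_one, mul_one,
    prod_eq]

/-- The BEST theorem, with the cofactor of the Laplacian in place of the number of spanning
arborescences. -/
theorem IsBalanced.eulerCount_eq [Fintype V] {s t : E → V} (hbal : IsBalanced s t) {r : V}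
    (hr : ∃ e, t e = r) :
    (eulerCount s t : ℚ) =
      (∏ v, (#{e | t e = v} - 1)! : ℕ) * (rootedLaplacian r s t).det := by
  classical
  induction hE : Fintype.card E generalizing E with
  | zero => have := hr.nonempty; exact absurd hE Fintype.card_ne_zero
  | succ n ih =>
    by_cases ht : ∀ e, t e = r
    · have : Nonempty E := hr.nonempty
      exact hbal.eulerCount_of_forall_target_eq ht
    push Not at ht
    obtain ⟨e, he⟩ := ht
    let f : Option {x // x ≠ e} ≃ E := optionSubtypeNe e
    have card_ne : Fintype.card {x // x ≠ e} = n := by simp [Fintype.card_subtype_compl, hE]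
    obtain ⟨x, hx⟩ : ∃ x, t (f (some x)) = r := by
      obtain ⟨x, hx⟩ := hr
      exact ⟨⟨x, fun h => he (h ▸ hx)⟩, by simpa [f] using hx⟩
    have : Nonempty {x // x ≠ e} := ⟨x⟩
    have hbal_f := hbal.comp_equiv f
    have card_comp (v : V) : #{x | (t ∘ f) x = v} = #{e | t e = v} :=
      Finset.card_equiv f (by simp)
    calc (eulerCount s t : ℚ)
        = ∑ i with (s ∘ f) (some i) = (t ∘ f) none,
            (eulerCount (spliceSource (s ∘ f) i) ((t ∘ f) ∘ some) : ℚ) := by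
          rw [← eulerCount_comp_equiv f, eulerCount_option, Nat.cast_sum]
      _ = ∑ i with (s ∘ f) (some i) = (t ∘ f) none,
            (∏ v, (#{x | (t ∘ f) (some x) = v} - 1)! : ℕ) *
              (rootedLaplacian r (spliceSource (s ∘ f) i) ((t ∘ f) ∘ some)).det :=
          Finset.sum_congr rfl fun i hi =>
            ih (hbal_f.splice (Finset.mem_filter.1 hi).2) ⟨x, hx⟩ card_ne
      _ = (∏ v, (#{e | t e = v} - 1)! : ℕ) * (rootedLaplacian r s t).det := by
          rw [← prod_factorial_mul_det_option hbal_f (by simpa [f] using he),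
            rootedLaplacian_comp_equiv]
          simp_rw [card_comp]

end BEST

section UniversalCycles
open Equiv Equiv.Perm
open scoped Finset

variable {α β E V : Type*}

/-- The pairs of cyclically consecutive entries of a cycle, in cyclic order. -/
def cyclicPairs : Cycle α → Cycle (α × α) :=
  Quotient.map (fun l => l.zip (l.rotate 1)) <| by
    rintro l _ ⟨n, rfl⟩
    exact ⟨n, by simp [List.zip, List.zipWith_rotate_distrib, List.rotate_rotate, add_comm]⟩

theorem cyclicPairs_coe (l : List α) : cyclicPairs (l : Cycle α) = (l.zip (l.rotate 1) : List _) :=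
  rfl

theorem length_cyclicPairs (c : Cycle α) : (cyclicPairs c).length = c.length := by
  induction c using Quotient.inductionOn' with
  | h l => exact (show (l.zip (l.rotate 1)).length = l.length by simp)

theorem map_injective_cycle {f : α → β} (hf : Function.Injective f) :
    Function.Injective (Cycle.map f) := by
  rintro ⟨l⟩ ⟨l'⟩ h
  obtain ⟨n, hn⟩ : l.map f ~r l'.map f := Quotient.exact h
  refine Quotient.sound ⟨n, hf.list_map ?_⟩
  rw [List.map_rotate, hn]

theorem zip_rotate_map_eq_map_iff [DecidableEq E] {l : List E} (hl : l.Nodup) (s t : E → V) :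
    (l.map s).zip ((l.map s).rotate 1) = l.map (fun e => (s e, t e)) ↔
      ∀ e ∈ l, s (l.formPerm e) = t e := by
  have next (i : ℕ) (hi : i < l.length) :
      l.formPerm l[i] = l[(i + 1) % l.length]'(Nat.mod_lt _ (by omega)) :=
    List.formPerm_apply_getElem l hl i hi
  simp only [List.ext_getElem_iff, List.forall_mem_iff_forall_getElem, next]
  simp [List.getElem_rotate]

theorem cyclicBlocks_two_eq {c : Cycle α} (hc : 2 ≤ c.length) :
    cyclicBlocks 2 c = (cyclicPairs c).toMultiset.map fun p => [p.1, p.2] := by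
  induction c using Quotient.inductionOn' with | h l
  change 2 ≤ l.length at hc
  have ne_nil : l ≠ [] := by rintro rfl; simp at hc
  refine congrArg Multiset.ofList (?_ : l.cyclicPermutations.map (List.take 2) =
    (l.zip (l.rotate 1)).map fun p => [p.1, p.2])
  refine List.ext_getElem (by simp [List.length_cyclicPermutations_of_ne_nil _ ne_nil]) ?_
  intro i h h'
  have take_two (l : List α) (hl : 2 ≤ l.length) : l.take 2 = [l[0], l[1]] := by
    match l, hl with
    | _ :: _ :: _, _ => simp
  have hi : i < l.length := by simpa using h'
  simp [List.getElem_cyclicPermutations, take_two, hc, List.getElem_rotate,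
    Nat.mod_eq_of_lt hi, add_comm]

theorem eq_val_iff_card_eq_and_count_eq_one [DecidableEq α] {M : Multiset α} {S : Finset α} :
    M = S.val ↔ M.card = #S ∧ ∀ a ∈ S, M.count a = 1 := by
  constructor
  · rintro rfl
    exact ⟨rfl, fun a ha => Multiset.count_eq_one_of_mem S.nodup ha⟩
  · rintro ⟨card_eq, count_eq⟩
    refine (Multiset.eq_of_le_of_card_le (Finset.val_le_iff_val_subset.2 fun a ha => ?_)
      card_eq.le).symm
    exact Multiset.count_pos.1 (by rw [count_eq a ha]; exact one_pos)

theorem isUniversalCycle_two_iff {n : ℕ} (hn : 2 ≤ n) {c : Cycle (Fin n)} :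
    IsUniversalCycle n 2 c ↔
      (cyclicPairs c).toMultiset = (Finset.univ.offDiag : Finset (Fin n × Fin n)).val := by
  have card_perm : Fintype.card (KPermutation n 2) = n * (n - 1) := by
    simp [Fintype.card_embedding_eq, Nat.descFactorial, mul_comm]
  have card_pairs : #(Finset.univ.offDiag : Finset (Fin n × Fin n)) = n * (n - 1) := by
    rw [Finset.offDiag_card, Finset.card_fin, Nat.mul_sub_one]
  rw [IsUniversalCycle, eq_val_iff_card_eq_and_count_eq_one, Cycle.card_toMultiset,
    length_cyclicPairs, card_perm, card_pairs]
  refine and_congr_right fun length_eq => ?_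
  have two_le : 2 ≤ c.length := by
    rw [length_eq]
    exact Nat.mul_le_mul hn (Nat.le_sub_of_add_le hn : 1 ≤ n - 1)
  have pair_injective : Function.Injective fun p : Fin n × Fin n => [p.1, p.2] := by
    rintro ⟨a, b⟩ ⟨a', b'⟩ h
    simpa using h
  have count_pair (a b : Fin n) :
      (cyclicBlocks 2 c).count [a, b] = (cyclicPairs c).toMultiset.count (a, b) := by
    rw [cyclicBlocks_two_eq two_le]
    exact Multiset.count_map_eq_count' _ _ pair_injective (a, b)
  have ofFn_eq (p : KPermutation n 2) : List.ofFn p = [p 0, p 1] := by simp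
  simp only [ofFn_eq, count_pair, Prod.forall, Finset.mem_offDiag, Finset.mem_univ, true_and]
  refine ⟨fun h a b hab => ?_, fun h p => h _ _ (p.injective.ne zero_ne_one)⟩
  exact h ⟨![a, b], by simpa [Function.Injective, Fin.forall_fin_two, eq_comm] using hab⟩

theorem exists_nodup_map_eq [Fintype E] {f : E → β} (hf : Function.Injective f) {w : List β}
    (hw : (w : Multiset β) = Finset.univ.val.map f) :
    ∃ l : List E, l.Nodup ∧ (∀ e, e ∈ l) ∧ l.map f = w := by
  obtain ⟨l, rfl⟩ : w ∈ Set.range (List.map f) := by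
    rw [Set.range_list_map]
    intro b hb
    rw [← Multiset.mem_coe, hw] at hb
    simpa using hb
  have coe_eq : (l : Multiset E) = Finset.univ.val := Multiset.map_injective hf hw
  refine ⟨l, ?_, fun e => ?_, rfl⟩
  · rw [← Multiset.coe_nodup, coe_eq]
    exact Finset.univ.nodup
  · rw [← Multiset.mem_coe, coe_eq]
    exact Finset.mem_univ e

theorem IsEulerianCircuit.isCycle [Nontrivial E] {s t : E → V} {σ : Perm E}
    (h : IsEulerianCircuit s t σ) : σ.IsCycle := by
  obtain ⟨e⟩ : Nonempty E := inferInstance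
  exact ⟨e, apply_ne_of_forall_sameCycle h.1 e, fun f _ => h.1 e f⟩

theorem two_le_length_of_forall_mem [Nontrivial E] {l : List E} (h : ∀ e, e ∈ l) :
    2 ≤ l.length := by
  obtain ⟨e, f, hne⟩ := exists_pair_ne E
  by_contra! hl
  match l, h e, h f, hl with
  | [_], he, hf, _ => exact hne ((List.mem_singleton.1 he).trans (List.mem_singleton.1 hf).symm)

section FormPerm

variable [DecidableEq E]

theorem isEulerianCircuit_formPerm_iff [Nontrivial E] {l : List E} (nodup : l.Nodup)
    (mem : ∀ e, e ∈ l) (s t : E → V) :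
    IsEulerianCircuit s t l.formPerm ↔
      (l.map s).zip ((l.map s).rotate 1) = l.map fun e => (s e, t e) := by
  have two_le := two_le_length_of_forall_mem mem
  have moves (e : E) : l.formPerm e ≠ e :=
    (List.formPerm_apply_mem_ne_self_iff _ nodup e (mem e)).2 two_le
  have sameCycle (e f : E) : l.formPerm.SameCycle e f :=
    (List.isCycle_formPerm nodup two_le).sameCycle (moves e) (moves f)
  rw [zip_rotate_map_eq_map_iff nodup]
  exact ⟨fun h e _ => h.2 e, fun h => ⟨sameCycle, fun e => h e (mem e)⟩⟩

variable [Fintype E]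

theorem toCycle_formPerm {l : List E} (nodup : l.Nodup) (two_le : 2 ≤ l.length) :
    l.formPerm.toCycle (List.isCycle_formPerm nodup two_le) = l := by
  have mem : l[0] ∈ l := List.getElem_mem _
  rw [toCycle_eq_toList _ _ l[0] ((List.formPerm_apply_mem_ne_self_iff _ nodup _ mem).2 two_le)]
  exact Quotient.sound (toList_formPerm_isRotated_self l two_le nodup _ mem)

variable [Nontrivial E]

theorem IsEulerianCircuit.exists_toCycle_eq {s t : E → V} {σ : Perm E}
    (h : IsEulerianCircuit s t σ) :
    ∃ l : List E, σ.toCycle h.isCycle = l ∧ l.Nodup ∧ (∀ e, e ∈ l) ∧ l.formPerm = σ := by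
  obtain ⟨e⟩ : Nonempty E := inferInstance
  have ne := apply_ne_of_forall_sameCycle h.1
  refine ⟨σ.toList e, toCycle_eq_toList σ _ e (ne e), nodup_toList σ e, fun f => ?_, ?_⟩
  · exact mem_toList_iff.2 ⟨h.1 e f, mem_support.2 (ne e)⟩
  · rw [formPerm_toList, h.isCycle.cycleOf_eq (ne e)]

theorem IsEulerianCircuit.cyclicPairs_map_toCycle {s t : E → V} {σ : Perm E}
    (h : IsEulerianCircuit s t σ) :
    cyclicPairs ((σ.toCycle h.isCycle).map s) = (σ.toCycle h.isCycle).map fun e => (s e, t e) := by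
  obtain ⟨l, toCycle_eq, nodup, -, formPerm_eq⟩ := h.exists_toCycle_eq
  have := (zip_rotate_map_eq_map_iff nodup s t).2 fun e _ => by rw [formPerm_eq, h.2]
  rw [toCycle_eq, Cycle.map_coe, Cycle.map_coe, cyclicPairs_coe, this]

theorem IsEulerianCircuit.toMultiset_cyclicPairs {s t : E → V} {σ : Perm E}
    (h : IsEulerianCircuit s t σ) :
    (cyclicPairs ((σ.toCycle h.isCycle).map s)).toMultiset =
      Finset.univ.val.map fun e => (s e, t e) := by
  obtain ⟨l, toCycle_eq, nodup, mem, -⟩ := h.exists_toCycle_eq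
  have coe_eq : (l : Multiset E) = Finset.univ.val :=
    (Multiset.Nodup.ext (Multiset.coe_nodup.2 nodup) Finset.univ.nodup).2 (by simpa using mem)
  rw [h.cyclicPairs_map_toCycle, toCycle_eq, Cycle.map_coe, Cycle.coe_toMultiset,
    ← Multiset.map_coe, coe_eq]

theorem exists_isEulerianCircuit_toCycle_map_eq {s t : E → V}
    (hst : Function.Injective fun e => (s e, t e)) {c : Cycle V}
    (hc : (cyclicPairs c).toMultiset = Finset.univ.val.map fun e => (s e, t e)) :
    ∃ σ, ∃ h : IsEulerianCircuit s t σ, (σ.toCycle h.isCycle).map s = c := by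
  induction c using Quotient.inductionOn' with | h w
  obtain ⟨l, nodup, mem, hl⟩ := exists_nodup_map_eq hst hc
  have w_eq : w = l.map s := by
    have := congrArg (List.map Prod.fst) hl
    rw [List.map_fst_zip (by simp), List.map_map] at this
    exact this.symm
  have circuit : IsEulerianCircuit s t l.formPerm :=
    (isEulerianCircuit_formPerm_iff nodup mem s t).2 (by rw [← w_eq, hl])
  refine ⟨l.formPerm, circuit, ?_⟩
  rw [toCycle_formPerm nodup (two_le_length_of_forall_mem mem), Cycle.map_coe, w_eq]
  rfl

end FormPerm

theorem eulerCount_eq_ncard_cycle [Fintype E] [Nontrivial E] {s t : E → V}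
    (hst : Function.Injective fun e => (s e, t e)) :
    eulerCount s t =
      {c : Cycle V |
        (cyclicPairs c).toMultiset = Finset.univ.val.map fun e => (s e, t e)}.ncard := by
  classical
  refine Set.ncard_congr (fun σ h => (σ.toCycle h.isCycle).map s)
    (fun σ h => h.toMultiset_cyclicPairs) (fun σ τ hσ hτ h => ?_) fun c hc => ?_
  · have toCycle_eq : σ.toCycle hσ.isCycle = τ.toCycle hτ.isCycle := by
      apply map_injective_cycle hst
      rw [← hσ.cyclicPairs_map_toCycle, ← hτ.cyclicPairs_map_toCycle, h]
    exact congrArg Subtype.val (isoCycle.injective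
      (a₁ := ⟨σ, hσ.isCycle⟩) (a₂ := ⟨τ, hτ.isCycle⟩) (Subtype.ext toCycle_eq))
  · exact exists_isEulerianCircuit_toCycle_map_eq hst hc

end UniversalCycles

section CompleteDigraph
open Matrix
open scoped Finset

variable {V : Type*}

/-- The edges of the complete loopless directed graph on `V`. -/
abbrev OffDiag (V : Type*) : Type _ :=
  {p : V × V // p.1 ≠ p.2}

theorem exists_offDiag_snd_eq [Nontrivial V] (v : V) : ∃ e : OffDiag V, e.1.2 = v := by
  obtain ⟨w, hw⟩ := exists_ne v
  exact ⟨⟨(w, v), by simpa using hw⟩, rfl⟩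

instance [Nontrivial V] : Nontrivial (OffDiag V) := by
  obtain ⟨v, w, h⟩ := exists_pair_ne V
  exact ⟨⟨(v, w), by simpa using h⟩, ⟨(w, v), by simpa using h.symm⟩, by simp [h]⟩

variable [Fintype V] [DecidableEq V]

theorem map_val_univ_offDiag :
    (Finset.univ : Finset (OffDiag V)).val.map Subtype.val =
      (Finset.univ.offDiag : Finset (V × V)).val := by
  refine congrArg Finset.val
    (?_ : Finset.univ.map (Function.Embedding.subtype _) = Finset.univ.offDiag)
  ext p
  simp

theorem card_filter_offDiag_snd_eq (v : V) :
    #{e : OffDiag V | e.1.2 = v} = Fintype.card V - 1 := by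
  rw [← Finset.card_univ, ← Finset.card_erase_of_mem (Finset.mem_univ v)]
  refine Finset.card_bij' (fun e _ => e.1.1)
    (fun w hw => ⟨(w, v), by simpa using hw⟩) ?_ ?_ ?_ ?_
  · rintro ⟨⟨w, u⟩, hwu⟩ h
    obtain rfl : u = v := by simpa using h
    simpa using hwu
  · simp
  · rintro ⟨⟨w, u⟩, hwu⟩ h
    obtain rfl : u = v := by simpa using h
    rfl
  · simp

theorem isBalanced_offDiag : IsBalanced (fun e : OffDiag V => e.1.1) fun e => e.1.2 := by
  let swap : OffDiag V ≃ OffDiag V := (Equiv.prodComm V V).subtypeEquiv fun p => by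
    simp [ne_comm]
  exact fun v => Finset.card_equiv swap fun e => by simp [swap]

theorem sum_offDiag {A : Type*} [AddCommMonoid A] (F : V → V → A) (hF : ∀ v, F v v = 0) :
    ∑ e : OffDiag V, F e.1.1 e.1.2 = ∑ v, ∑ w, F v w := by
  rw [← Finset.sum_subtype Finset.univ.offDiag (by simp) fun p => F p.1 p.2,
    ← Fintype.sum_prod_type']
  refine Finset.sum_subset (Finset.subset_univ _) ?_
  rintro ⟨v, w⟩ - h
  obtain rfl : v = w := by simpa using h
  exact hF v

theorem rootedLaplacian_offDiag [Nontrivial V] (r : V) :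
    rootedLaplacian r (fun e : OffDiag V => e.1.1) (fun e => e.1.2) =
      diagonal (Function.update (fun _ => (Fintype.card V : ℚ)) r (Fintype.card V + 1)) -
        vecMulVec 1 1 := by
  have has_source (v : V) : ¬ ∀ e : OffDiag V, e.1.2 ≠ v := by
    simpa using exists_offDiag_snd_eq v
  have sum_eq := sum_offDiag (fun v w : V =>
    vecMulVec (Pi.single v (1 : ℚ)) (Pi.single v 1 - Pi.single w 1)) (by simp)
  rw [rootedLaplacian, sum_eq]
  ext v w
  simp only [has_source, or_false]
  by_cases hw : v = w
  · subst hw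
    by_cases hv : v = r <;> simp [Matrix.sum_apply, vecMulVec_apply, Pi.single_apply, hv]
  · simp [Matrix.sum_apply, vecMulVec_apply, Pi.single_apply, hw, eq_comm]

end CompleteDigraph

theorem theorem1 (n : ℕ) (hn : 3 ≤ n) :
    {c : Cycle (Fin n) | IsUniversalCycle n 2 c}.ncard = n ^ (n - 2) * ((n - 2)!) ^ n := by
  have two_le : 2 ≤ n := by omega
  have : Nontrivial (Fin n) := Fin.nontrivial_iff_two_le.2 two_le
  obtain ⟨r⟩ : Nonempty (Fin n) := inferInstance
  have circuits : {c : Cycle (Fin n) | IsUniversalCycle n 2 c}.ncard =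
      eulerCount (fun e : OffDiag (Fin n) => e.1.1) fun e => e.1.2 := by
    simp_rw [isUniversalCycle_two_iff two_le, ← map_val_univ_offDiag]
    exact (eulerCount_eq_ncard_cycle Subtype.val_injective).symm
  rw [circuits, ← Nat.cast_inj (R := ℚ),
    isBalanced_offDiag.eulerCount_eq (exists_offDiag_snd_eq r), rootedLaplacian_offDiag,
    det_diagonal_update_card_sub_vecMulVec_one]
  simp [card_filter_offDiag_snd_eq, mul_comm, Nat.sub_sub]
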